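/- Throughout, $\mathcal B$, $\mathcal A$, $\mathcal C$ are abelian categories. A *left recollement* $(\mathcal B,\mathcal A,\mathcal C,i^*,i_*,j_!,j^*)$ consists of functors $i^*:\mathcal A\to\mathcal B$, $i_*:\mathcal B\to\mathcal A$, $j_!:\mathcal C\to\mathcal A$, $j^*:\mathcal A\to\mathcal C$ such that (i) $i_*$ and $j^*$ are exact; (ii) $i_*$ and $j_!$ are fully faithful; (iii) $(i^*,i_*)$ and $(j_!,j^*)$ are adjoint pairs (left adjoint written first); (iv) $\operatorname{Im} i_*=\operatorname{Ker} j^*$, i.e. an object $X$ of $\mathcal A$ is isomorphic to $i_*Y$ for some object $Y$ of $\mathcal B$ if and only if $j^*X=0$. A *recollement* $(\mathcal B,\mathcal A,\mathcal C,i^*,i_*,i^!,j_!,j^*,j_*)$ consists of functors $i^*,i^!:\mathcal A\to\mathcal B$, $i_*:\mathcal B\to\mathcal A$, $j_!,j_*:\mathcal C\to\mathcal A$, $j^*:\mathcal A\to\mathcal C$ such that (i) $(i^*,i_*)$, $(i_*,i^!)$, $(j_!,j^*)$, $(j^*,j_*)$ are adjoint pairs; (ii) $i_*$, $j_!$ and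 $j_*$ are fully faithful; (iii) $\operatorname{Im} i_*=\operatorname{Ker} j^*$. **Theorem 1.2.** Assume that $\mathcal A$ is a Grothendieck category (an abelian category with a generator and small coproducts in which filtered colimits are exact). Then any left recollement $(\mathcal B,\mathcal A,\mathcal C,i^*,i_*,j_!,j^*)$ of abelian categories can be extended to a recollement of abelian categories: there exist functors $i^!:\mathcal A\to\mathcal B$ and $j_*:\mathcal C\to\mathcal A$ such that $(\mathcal B,\mathcal A,\mathcal C,i^*,i_*,i^!,j_!,j^*,j_*)$ is a recollement. -/

import Mathlib

open CategoryTheory CategoryTheory.Limits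

universe w v₁ v₂ v₃ u₁ u₂ u₃

section Recollement

variable {B : Type u₁} [Category.{v₁} B] [Abelian B]
  {A : Type u₂} [Category.{v₂} A] [Abelian A]
  {C : Type u₃} [Category.{v₃} C] [Abelian C]

/-- A left recollement `(B, A, C, i^*, i_*, j_!, j^*)` of abelian categories. Here
`iUpperStar`, `iLowerStar`, `jLowerShriek`, `jUpperStar` are `i^*`, `i_*`, `j_!`, `j^*`;
`F ⊣ G` is the type of adjunctions with left adjoint `F` and right adjoint `G`.
`Im i_* = Ker j^*` is an equality of strictly full subcategories of `A`. -/
structure IsLeftRecollement (iUpperStar : A ⥤ B) (iLowerStar : B ⥤ A)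
    (jLowerShriek : C ⥤ A) (jUpperStar : A ⥤ C) : Prop where
  exact_iLowerStar : exactFunctor B A iLowerStar
  exact_jUpperStar : exactFunctor A C jUpperStar
  full_iLowerStar : iLowerStar.Full
  faithful_iLowerStar : iLowerStar.Faithful
  full_jLowerShriek : jLowerShriek.Full
  faithful_jLowerShriek : jLowerShriek.Faithful
  adj_i : Nonempty (iUpperStar ⊣ iLowerStar)
  adj_j : Nonempty (jLowerShriek ⊣ jUpperStar)
  im_eq_ker : iLowerStar.essImage = jUpperStar.kernel

/-- A recollement `(B, A, C, i^*, i_*, i^!, j_!, j^*, j_*)` of abelian categories. Here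
`iUpperStar`, `iLowerStar`, `iUpperShriek` are `i^*`, `i_*`, `i^!`, and
`jLowerShriek`, `jUpperStar`, `jLowerStar` are `j_!`, `j^*`, `j_*`. -/
structure IsRecollement (iUpperStar : A ⥤ B) (iLowerStar : B ⥤ A) (iUpperShriek : A ⥤ B)
    (jLowerShriek : C ⥤ A) (jUpperStar : A ⥤ C) (jLowerStar : C ⥤ A) : Prop where
  adj_iUpperStar_iLowerStar : Nonempty (iUpperStar ⊣ iLowerStar)
  adj_iLowerStar_iUpperShriek : Nonempty (iLowerStar ⊣ iUpperShriek)
  adj_jLowerShriek_jUpperStar : Nonempty (jLowerShriek ⊣ jUpperStar)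
  adj_jUpperStar_jLowerStar : Nonempty (jUpperStar ⊣ jLowerStar)
  full_iLowerStar : iLowerStar.Full
  faithful_iLowerStar : iLowerStar.Faithful
  full_jLowerShriek : jLowerShriek.Full
  faithful_jLowerShriek : jLowerShriek.Faithful
  full_jLowerStar : jLowerStar.Full
  faithful_jLowerStar : jLowerStar.Faithful
  im_eq_ker : iLowerStar.essImage = jUpperStar.kernel

end Recollement

/-! The crux is that `j^*` preserves coproducts. In a Grothendieck category a coproduct embeds in
the product, and `j^*`, exact and a right adjoint, preserves that embedding and the product, so its
kernel is closed under coproducts. The counits `j_! j^* X ⟶ X` have kernel and cokernel in `Ker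
j^*`; since coproducts are exact, so does any coproduct of counits, which `j^*` therefore inverts.
Hence `j^*(∐ X) ≅ j^* j_!(∐ j^* X) ≅ ∐ j^* X` (`Adjunction.preservesCoproducts_right`). The special
adjoint functor theorem then gives `j_*`, fully faithful because `j_!` is, and `i^! X` is the kernel
of `X ⟶ j_* j^* X`, viewed in `B`. -/

namespace CategoryTheory

section MonoToProduct

open Limits.CoproductsFromFiniteFiltered

/-- A morphism out of a filtered colimit is a monomorphism as soon as its restriction to every term
of the diagram is one. -/
lemma Limits.IsColimit.mono_of_forall_mono_ι_comp {A : Type u₂} [Category.{v₂} A]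
    {J : Type u₁} [Category.{v₁} J] [IsFiltered J] [HasColimitsOfShape J A]
    [(colim : (J ⥤ A) ⥤ A).PreservesMonomorphisms] {K : J ⥤ A} {c : Cocone K}
    (hc : IsColimit c) {Z : A} (f : c.pt ⟶ Z) [∀ j, Mono (c.ι.app j ≫ f)] : Mono f := by
  -- Connectedness makes `Z` the colimit of the constant diagram at `Z`, so `f` is the colimit of
  -- the monomorphism `φ`.
  have := IsFiltered.isConnected J
  let φ : K ⟶ (Functor.const J).obj Z :=
    { app := fun j => c.ι.app j ≫ f
      naturality := fun _ _ g => by simp }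
  have (j : J) : Mono (φ.app j) := inferInstanceAs (Mono (c.ι.app j ≫ f))
  have := NatTrans.mono_of_mono_app φ
  exact colim.map_mono' φ hc (isColimitConstCocone J Z) f (fun j => (Category.comp_id _).symm)

variable {A : Type u₂} [Category.{v₂} A] [Abelian A] [IsGrothendieckAbelian.{w} A]

/-- In a Grothendieck abelian category, the objects killed by a functor preserving limits and
monomorphisms are closed under coproducts. -/
lemma isZero_obj_sigma_of_isRightAdjoint {C : Type u₃} [Category.{v₃} C] [HasZeroMorphisms C]
    (G : A ⥤ C) [G.IsRightAdjoint] [G.PreservesMonomorphisms]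
    {α : Type w} (N : α → A) (hN : ∀ a, IsZero (G.obj (N a))) : IsZero (G.obj (∐ N)) := by
  classical
  let δ : ∐ N ⟶ ∏ᶜ N := Limits.Sigma.desc fun a => Pi.lift fun b =>
    if h : a = b then eqToHom (congrArg N h) else 0
  have hc := isColimitFiniteSubproductsCocone N
  have (S : Finset (Discrete α)) : Mono ((finiteSubcoproductsCocone N).ι.app S ≫ δ) := by
    -- On a finite subcoproduct, `δ` is split by projecting the product onto the finitely many
    -- factors in `S`, where product and coproduct agree.
    let l : (∐ fun x : S => N x.1.as) ⟶ ∐ N := Limits.Sigma.desc fun x => Sigma.ι N x.1.as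
    let r : ∏ᶜ N ⟶ ∐ fun x : S => N x.1.as :=
      ∑ x : S, Pi.π N x.1.as ≫ Sigma.ι (fun x : S => N x.1.as) x
    have hr : (l ≫ δ) ≫ r = 𝟙 _ := by
      refine Sigma.hom_ext _ _ fun x => ?_
      have hx (y : S) : Sigma.ι (fun x : S => N x.1.as) x ≫ (l ≫ δ) ≫ Pi.π N y.1.as =
          if h : x.1.as = y.1.as then eqToHom (congrArg N h) else 0 := by
        simp only [l, δ, Category.assoc, Sigma.ι_desc_assoc]
        simp
      simp only [r, Preadditive.comp_sum]
      rw [Finset.sum_eq_single x]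
      · simpa using congr($(hx x) ≫ Sigma.ι (fun x : S => N x.1.as) x)
      · intro y _ hy
        have hne : x.1.as ≠ y.1.as := fun h => hy (Subtype.ext (Discrete.ext h.symm))
        simpa [hne] using congr($(hx y) ≫ Sigma.ι (fun x : S => N x.1.as) y)
      · simp
    exact (SplitMono.mk r hr).mono
  have : Mono δ := hc.mono_of_forall_mono_ι_comp δ
  have hprod : IsZero (G.obj (∏ᶜ N)) := by
    have hl := isLimitOfHasProductOfPreservesLimit G N
    rw [IsZero.iff_id_eq_zero]
    exact Fan.IsLimit.hom_ext hl _ _ fun a => (hN a).eq_of_tgt _ _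
  rw [IsZero.iff_id_eq_zero, ← cancel_mono (G.map δ)]
  exact hprod.eq_of_tgt _ _

end MonoToProduct

section Exact

variable {A : Type u₂} [Category.{v₂} A] [Abelian A] {C : Type u₃} [Category.{v₃} C] [Abelian C]

lemma isZero_obj_kernel_of_mono (G : A ⥤ C) [PreservesFiniteLimits G]
    [G.PreservesZeroMorphisms] {X Y : A} (f : X ⟶ Y) [Mono (G.map f)] :
    IsZero (G.obj (kernel f)) :=
  (isZero_kernel_of_mono (G.map f)).of_iso (PreservesKernel.iso G f)

lemma isZero_obj_cokernel_of_epi (G : A ⥤ C) [PreservesFiniteColimits G]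
    [G.PreservesZeroMorphisms] {X Y : A} (f : X ⟶ Y) [Epi (G.map f)] :
    IsZero (G.obj (cokernel f)) :=
  (isZero_cokernel_of_epi (G.map f)).of_iso (PreservesCokernel.iso G f)

/-- The kernel of an exact functor is a Serre class, and the functor inverts the isomorphisms modulo
that class. -/
lemma isIso_map_of_isZero_obj_kernel_cokernel (G : A ⥤ C) [PreservesFiniteLimits G]
    [PreservesFiniteColimits G] {X Y : A} (f : X ⟶ Y)
    (hk : IsZero (G.obj (kernel f))) (hc : IsZero (G.obj (cokernel f))) : IsIso (G.map f) :=
  (G.kernel.isoModSerre_isInvertedBy_iff G).2 le_rfl f ⟨hk, hc⟩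

variable [IsGrothendieckAbelian.{w} A]

/-- Morphisms inverted by an exact right adjoint functor from a Grothendieck abelian category
are stable under coproducts. -/
lemma isIso_map_colimMap_of_isIso (G : A ⥤ C) [G.IsRightAdjoint]
    [PreservesFiniteLimits G] [PreservesFiniteColimits G] {α : Type w}
    {K L : Discrete α ⥤ A} (φ : K ⟶ L) [∀ a, IsIso (G.map (φ.app a))] :
    IsIso (G.map (colim.map φ)) := by
  have key (N : Discrete α ⥤ A) (hN : ∀ a, IsZero (G.obj (N.obj a))) :
      IsZero ((colim ⋙ G).obj N) :=
    (isZero_obj_sigma_of_isRightAdjoint G (fun a => N.obj ⟨a⟩) (fun a => hN _)).of_iso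
      (G.mapIso (HasColimit.isoOfNatIso Discrete.natIsoFunctor))
  have hφ (a : Discrete α) : IsIso (((evaluation _ A).obj a ⋙ G).map φ) :=
    inferInstanceAs (IsIso (G.map (φ.app a)))
  -- `colim ⋙ G` is exact because coproducts in `A` are; kernels and cokernels of `φ` are tested
  -- pointwise by the exact evaluation functors.
  exact isIso_map_of_isZero_obj_kernel_cokernel (colim ⋙ G) φ
    (key _ fun a => isZero_obj_kernel_of_mono ((evaluation _ A).obj a ⋙ G) φ)
    (key _ fun a => isZero_obj_cokernel_of_epi ((evaluation _ A).obj a ⋙ G) φ)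

/-- An exact functor on a Grothendieck abelian category with a fully faithful left adjoint
preserves coproducts. -/
lemma Adjunction.preservesCoproducts_right {F : C ⥤ A} {G : A ⥤ C} (adj : F ⊣ G) [F.Full]
    [F.Faithful] [PreservesFiniteLimits G] [PreservesFiniteColimits G] (α : Type w) :
    PreservesColimitsOfShape (Discrete α) G where
  preservesColimit {K} := by
    have := adj.isRightAdjoint
    let _ : Coreflective F := { R := G, adj := adj }
    have := hasColimitsOfShape_of_coreflective (J := Discrete α) F
    let φ : (K ⋙ G) ⋙ F ⟶ K := Functor.whiskerLeft K adj.counit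
    have (a : Discrete α) : IsIso (G.map (φ.app a)) :=
      inferInstanceAs (IsIso (G.map (adj.counit.app (K.obj a))))
    have := isIso_map_colimMap_of_isIso G φ
    -- Both `F` (a left adjoint) and `F ⋙ G ≅ 𝟭` preserve the coproduct of `K ⋙ G`, so `G` preserves
    -- its image under `F`. The remaining steps transport this to `K` along `φ`, which `G` inverts
    -- both termwise and on colimits.
    have : PreservesColimit ((K ⋙ G) ⋙ F) G :=
      have := adj.isLeftAdjoint
      have : PreservesColimitsOfShape (Discrete α) F := adj.leftAdjoint_preservesColimits.1
      have : PreservesColimit (K ⋙ G) (F ⋙ G) :=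
        preservesColimit_of_natIso _ (asIso adj.unit)
      preservesColimit_of_preserves_colimit_cocone
        (isColimitOfPreserves F (colimit.isColimit (K ⋙ G)))
        (isColimitOfPreserves (F ⋙ G) (colimit.isColimit (K ⋙ G)))
    refine preservesColimit_of_preserves_colimit_cocone (colimit.isColimit K) ?_
    let e : ((K ⋙ G) ⋙ F) ⋙ G ≅ K ⋙ G :=
      NatIso.ofComponents (fun a => asIso (G.map (φ.app a)))
        (fun g => by
          simp only [Functor.comp_map, asIso_hom, ← G.map_comp]
          exact congrArg G.map (φ.naturality g))
    refine (IsColimit.precomposeHomEquiv e _).1 ?_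
    refine IsColimit.ofIsoColimit (isColimitOfPreserves G (colimit.isColimit ((K ⋙ G) ⋙ F)))
      (Cocone.ext (asIso (G.map (colim.map φ))) fun a => ?_)
    change G.map _ ≫ G.map (colim.map φ) = G.map (φ.app a) ≫ G.map _
    rw [← G.map_comp, ← G.map_comp]
    exact congrArg G.map (ι_colimMap φ a)

/-- Right exactness supplies coequalizers, which with coproducts build all small colimits. -/
lemma Adjunction.preservesColimitsOfSize_right {F : C ⥤ A} {G : A ⥤ C} (adj : F ⊣ G) [F.Full]
    [F.Faithful] [PreservesFiniteLimits G] [PreservesFiniteColimits G] :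
    PreservesColimitsOfSize.{w, w} G :=
  have (α : Type w) := adj.preservesCoproducts_right α
  preservesColimits_of_preservesCoequalizers_and_coproducts G

end Exact

/-- The special adjoint functor theorem for Grothendieck abelian categories. -/
lemma IsGrothendieckAbelian.isLeftAdjoint_of_preservesColimits
    {A : Type u₂} [Category.{v₂} A] [Abelian A] [IsGrothendieckAbelian.{w} A]
    {C : Type u₃} [Category.{v₃} C] [LocallySmall.{w} C] (G : A ⥤ C)
    [PreservesColimitsOfSize.{w, w} G] : G.IsLeftAdjoint := by
  -- The adjoint functor theorem is applied to models whose hom-sets lie in the universe `w` of the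
  -- small colimits.
  let eA := ShrinkHoms.equivalence.{w} A
  let eC := ShrinkHoms.equivalence.{w} C
  let G' : ShrinkHoms A ⥤ ShrinkHoms C := eA.inverse ⋙ G ⋙ eC.functor
  have : G'.IsLeftAdjoint :=
    isLeftAdjoint_of_preservesColimits_of_isSeparating (isSeparator_separator (ShrinkHoms A)) G'
  let e : eA.functor ⋙ G' ⋙ eC.inverse ≅ G :=
    Functor.isoWhiskerRight eA.unitIso.symm (G ⋙ eC.functor ⋙ eC.inverse) ≪≫
      Functor.isoWhiskerLeft G eC.unitIso.symm
  exact Functor.isLeftAdjoint_of_iso e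

/-- If `i` is fully faithful with essential image the kernel of `G`, and `G` is left exact with a
fully faithful right adjoint, then `i` has a right adjoint, sending `X` to the kernel of the unit
at `X`. -/
lemma Adjunction.isLeftAdjoint_of_essImage_eq_kernel {B : Type u₁} [Category.{v₁} B]
    {A : Type u₂} [Category.{v₂} A] [Abelian A] {C : Type u₃} [Category.{v₃} C] [Abelian C]
    (i : B ⥤ A) [i.Full] [i.Faithful] {G : A ⥤ C} {H : C ⥤ A} (adj : G ⊣ H) [H.Full] [H.Faithful]
    [PreservesFiniteLimits G] (hi : i.essImage = G.kernel) : i.IsLeftAdjoint := by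
  rw [isLeftAdjoint_iff_hasTerminal_costructuredArrow]
  intro X
  let η := adj.unit.app X
  have hk : i.essImage (kernel η) := by
    rw [hi]
    -- `G` inverts the unit because `H` is fully faithful.
    exact isZero_obj_kernel_of_mono G η
  obtain ⟨Y, ⟨e⟩⟩ := hk
  let T : CostructuredArrow i X := CostructuredArrow.mk (e.hom ≫ kernel.ι η)
  have (Z : CostructuredArrow i X) : Nonempty (Z ⟶ T) := by
    have hZ : G.kernel (i.obj Z.left) := hi ▸ i.obj_mem_essImage Z.left
    -- Its transpose under `adj` starts at `G.obj (i.obj Z.left)`, which is zero.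
    have h0 : Z.hom ≫ η = 0 :=
      (adj.homEquiv _ _).symm.injective (hZ.eq_of_src _ _)
    exact ⟨CostructuredArrow.homMk (i.preimage (kernel.lift η Z.hom h0 ≫ e.inv)) (by simp [T])⟩
  have (Z : CostructuredArrow i X) : Subsingleton (Z ⟶ T) := by
    refine ⟨fun f g => CostructuredArrow.hom_ext _ _ (i.map_injective ?_)⟩
    have := (CostructuredArrow.w f).trans (CostructuredArrow.w g).symm
    exact (cancel_mono (e.hom ≫ kernel.ι η)).1 this
  exact hasTerminal_of_unique T

end CategoryTheory


theorem theorem1p2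
    {B : Type u₁} [Category.{v₁} B] [Abelian B]
    {A : Type u₂} [Category.{v₂} A] [Abelian A] [IsGrothendieckAbelian.{w} A]
    {C : Type u₃} [Category.{v₃} C] [Abelian C]
    (iUpperStar : A ⥤ B) (iLowerStar : B ⥤ A) (jLowerShriek : C ⥤ A) (jUpperStar : A ⥤ C)
    (h : IsLeftRecollement iUpperStar iLowerStar jLowerShriek jUpperStar) :
    ∃ (iUpperShriek : A ⥤ B) (jLowerStar : C ⥤ A),
      IsRecollement iUpperStar iLowerStar iUpperShriek jLowerShriek jUpperStar jLowerStar := by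
  have := h.full_iLowerStar
  have := h.faithful_iLowerStar
  have := h.full_jLowerShriek
  have := h.faithful_jLowerShriek
  obtain ⟨adjj⟩ := h.adj_j
  have : PreservesFiniteLimits jUpperStar := h.exact_jUpperStar.1
  have : PreservesFiniteColimits jUpperStar := h.exact_jUpperStar.2
  -- `C` inherits local smallness from `A` through the embedding `j_!`.
  have : LocallySmall.{w} C := locallySmall_of_faithful jLowerShriek
  have : PreservesColimitsOfSize.{w, w} jUpperStar := adjj.preservesColimitsOfSize_right
  have := IsGrothendieckAbelian.isLeftAdjoint_of_preservesColimits.{w} jUpperStar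
  let adjj' := Adjunction.ofIsLeftAdjoint jUpperStar
  -- In an adjoint triple the outer functors are fully faithful simultaneously.
  let hff := (Adjunction.Triple.mk adjj adjj').fullyFaithfulEquiv (.ofFullyFaithful jLowerShriek)
  have := hff.full
  have := hff.faithful
  have := adjj'.isLeftAdjoint_of_essImage_eq_kernel iLowerStar h.im_eq_ker
  exact ⟨iLowerStar.rightAdjoint, jUpperStar.rightAdjoint,
    { adj_iUpperStar_iLowerStar := h.adj_i
      adj_iLowerStar_iUpperShriek := ⟨Adjunction.ofIsLeftAdjoint iLowerStar⟩
      adj_jLowerShriek_jUpperStar := h.adj_j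
      adj_jUpperStar_jLowerStar := ⟨adjj'⟩
      full_iLowerStar := h.full_iLowerStar
      faithful_iLowerStar := h.faithful_iLowerStar
      full_jLowerShriek := h.full_jLowerShriek
      faithful_jLowerShriek := h.faithful_jLowerShriek
      full_jLowerStar := hff.full
      faithful_jLowerStar := hff.faithful
      im_eq_ker := h.im_eq_ker }⟩
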